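/- Let $\ell\ge 2$ be an integer. A set $A$ of integers is called $\mathcal L_{2,\ell}$-free if it contains no sumset $L_1+L_2=\{\lambda_1+\lambda_2:\ \lambda_1\in L_1,\ \lambda_2\in L_2\}$ with $L_1,L_2\subset\mathbb Z$, $|L_1|=2$ and $|L_2|=\ell$. Write $A(x)=|A\cap[1,x]|$ for the counting function of $A$. Theorem. For every integer $\ell\ge 2$ and every real $\epsilon>0$ there exists an infinite $\mathcal L_{2,\ell}$-free set (sequence) $A$ of positive integers such that $$A(x)\gg x^{1-\frac{\ell}{2\ell-1}-\epsilon}\qquad (x\to\infty),$$ that is, there are constants $c>0$ and $x_0$ (which may depend on $\ell$, $\epsilon$ and $A$) with $A(x)\ge c\,x^{1-\frac{\ell}{2\ell-1}-\epsilon}$ for all real $x\ge x_0$. -/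

import Mathlib

/-- The sumset `L₁ + ⋯ + L_r = {x₁ + ⋯ + x_r : x_i ∈ L_i}` of finite subsets of an abelian group. -/
def iteratedSumset {G : Type*} [AddCommGroup G] {r : ℕ} (L : Fin r → Finset G) : Set G :=
  {s : G | ∃ x : Fin r → G, (∀ i, x i ∈ L i) ∧ ∑ i, x i = s}

/-- `A` is `𝓛^{(r)}_{ℓ₁,…,ℓ_r}`-free: it contains no sumset `L₁ + ⋯ + L_r` with `|L_i| = ℓ_i`. -/
def IsLFree {G : Type*} [AddCommGroup G] {r : ℕ} (ℓ : Fin r → ℕ) (A : Set G) : Prop :=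
  ∀ L : Fin r → Finset G, (∀ i, (L i).card = ℓ i) → ¬ iteratedSumset L ⊆ A

/-- The counting function `A(x) = |A ∩ [1, x]|` of a set of integers. -/
noncomputable def countingFunction (A : Set ℤ) (x : ℝ) : ℕ :=
  {a : ℤ | a ∈ A ∧ 1 ≤ a ∧ (a : ℝ) ≤ x}.ncard

/-! Put `m = ℓ - 1`. A sumset with `|L₁| = 2`, `|L₂| = ℓ` yields a nonzero difference represented `m
+ 1` times, so it suffices that no such difference exists. The set is built greedily, keeping at
most `n ^ 2 / t ^ j` differences with more than `j` representations for each `j < m`, where `n` is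
the size and `t = n ^ (1 / m)`. A new element `x` promotes only differences `±(x - a)` that were
already popular (`card_popularDifferences_insert_le`). On average over `x` these are few, so some
`x` of size `O(n ^ 2 * t)` preserves all the bounds (`IsBalanced.exists_good`,
`IsBalanced.exists_insert`). Hence `n` elements fit below `C * n ^ (2 + 1 / m)`. -/

open scoped Pointwise in
/-- The nonzero integers with at least `j` representations as a difference of two elements
of `A`. -/
def popularDifferences (A : Finset ℤ) (j : ℕ) : Finset ℤ :=
  {d ∈ A - A | d ≠ 0 ∧ j ≤ (A.filter fun a => a + d ∈ A).card}

theorem mem_popularDifferences {A : Finset ℤ} {j : ℕ} (hj : 1 ≤ j) {d : ℤ} :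
    d ∈ popularDifferences A j ↔ d ≠ 0 ∧ j ≤ (A.filter fun a => a + d ∈ A).card := by
  simp only [popularDifferences, Finset.mem_filter, and_iff_right_iff_imp]
  rintro ⟨-, h⟩
  obtain ⟨a, ha⟩ := Finset.card_pos.1 (lt_of_lt_of_le hj h)
  rw [Finset.mem_filter] at ha
  exact Finset.mem_sub.2 ⟨a + d, ha.2, a, ha.1, by ring⟩

theorem card_filter_add_neg (A : Finset ℤ) (d : ℤ) :
    (A.filter fun a => a + -d ∈ A).card = (A.filter fun a => a + d ∈ A).card := by
  refine Finset.card_bij' (fun a _ => a + -d) (fun a _ => a + d) ?_ ?_ ?_ ?_ <;>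
    simp +contextual

theorem card_popularDifferences_le_sq (A : Finset ℤ) (j : ℕ) :
    (popularDifferences A j).card ≤ A.card ^ 2 :=
  (Finset.card_filter_le _ _).trans ((Finset.card_sub_le ..).trans_eq (sq _).symm)

/-- The elements of `A` whose difference with `x` is popular. -/
def popularNeighbours (A : Finset ℤ) (j : ℕ) (x : ℤ) : Finset ℤ :=
  {a ∈ A | x - a ∈ popularDifferences A j}

/-- The only possible new pairs are `(x, x + d)` and `(x - d, x)`. Both at once would make `x` the
midpoint of two elements of `A`. -/
theorem card_filter_insert_le {A : Finset ℤ} {x d : ℤ}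
    (hx : ∀ a ∈ A, ∀ b ∈ A, 2 * x ≠ a + b) :
    ((insert x A).filter fun a => a + d ∈ insert x A).card ≤
      (A.filter fun a => a + d ∈ A).card + 1 := by
  by_cases h : x + d ∈ A
  · have h' : x - d ∉ A := fun h' => hx _ h _ h' (by ring)
    refine le_trans (Finset.card_le_card (t := insert x (A.filter fun a => a + d ∈ A)) ?_)
      (Finset.card_insert_le _ _)
    intro a ha
    simp only [Finset.mem_filter, Finset.mem_insert] at ha ⊢
    rcases ha with ⟨rfl | ha, h1 | h1⟩
    · exact Or.inl rfl
    · exact Or.inl rfl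
    · exact absurd (by rwa [show x - d = a by omega]) h'
    · exact Or.inr ⟨ha, h1⟩
  · refine le_trans (Finset.card_le_card (t := insert (x - d) (A.filter fun a => a + d ∈ A)) ?_)
      (Finset.card_insert_le _ _)
    intro a ha
    simp only [Finset.mem_filter, Finset.mem_insert] at ha ⊢
    rcases ha with ⟨rfl | ha, h1 | h1⟩
    · omega
    · exact absurd h1 h
    · exact Or.inl (by omega)
    · exact Or.inr ⟨ha, h1⟩

/-- Each count grows by at most one, so a newly promoted difference already had `j` representations
and involves `x`. The factor 2 accounts for both signs. -/
theorem card_popularDifferences_insert_le {A : Finset ℤ} {x : ℤ}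
    (hx : ∀ a ∈ A, ∀ b ∈ A, 2 * x ≠ a + b) {j : ℕ} (hj : 1 ≤ j) :
    (popularDifferences (insert x A) (j + 1)).card ≤
      (popularDifferences A (j + 1)).card + 2 * (popularNeighbours A j x).card := by
  have hsub : popularDifferences (insert x A) (j + 1) ⊆ popularDifferences A (j + 1) ∪
      ((popularNeighbours A j x).image (fun a => x - a) ∪
        (popularNeighbours A j x).image (fun a => a - x)) := by
    intro d hd
    rw [mem_popularDifferences (by omega)] at hd
    obtain ⟨hd0, hd⟩ := hd
    have hle := card_filter_insert_le (d := d) hx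
    rw [Finset.mem_union, mem_popularDifferences (by omega)]
    by_cases hold : j + 1 ≤ (A.filter fun a => a + d ∈ A).card
    · exact Or.inl ⟨hd0, hold⟩
    · right
      have hpop : j ≤ (A.filter fun a => a + d ∈ A).card := by omega
      have hnot : ¬ ((insert x A).filter fun a => a + d ∈ insert x A) ⊆
          A.filter fun a => a + d ∈ A := fun hs => by
        have := Finset.card_le_card hs
        omega
      obtain ⟨a, ha, ha'⟩ := Finset.not_subset.1 hnot
      simp only [Finset.mem_filter, Finset.mem_insert] at ha ha'
      simp only [Finset.mem_union, Finset.mem_image, popularNeighbours, Finset.mem_filter,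
        mem_popularDifferences hj]
      rcases ha with ⟨rfl | ha, h1 | h1⟩
      · omega
      · refine Or.inr ⟨a + d, ⟨h1, by omega, ?_⟩, by ring⟩
        rw [show a - (a + d) = -d by ring, card_filter_add_neg]
        exact hpop
      · refine Or.inl ⟨a, ⟨ha, by omega, ?_⟩, by omega⟩
        rw [show x - a = d by omega]
        exact hpop
      · exact absurd ⟨ha, h1⟩ ha'
  refine (Finset.card_le_card hsub).trans ((Finset.card_union_le _ _).trans ?_)
  have h1 := Finset.card_union_le ((popularNeighbours A j x).image (fun a => x - a))
    ((popularNeighbours A j x).image (fun a => a - x))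
  have h2 := Finset.card_image_le (s := popularNeighbours A j x) (f := fun a => x - a)
  have h3 := Finset.card_image_le (s := popularNeighbours A j x) (f := fun a => a - x)
  omega

/-! ### Averaging over the new element -/

theorem sum_card_popularNeighbours_le (A S : Finset ℤ) (j : ℕ) :
    ∑ x ∈ S, (popularNeighbours A j x).card ≤ A.card * (popularDifferences A j).card := by
  simp only [popularNeighbours]
  rw [← Finset.card_product, ← Finset.card_sigma]
  refine Finset.card_le_card_of_injOn (fun p => (p.2, p.1 - p.2)) ?_ ?_
  · rintro ⟨x, a⟩ h
    simp at h ⊢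
    exact h.2
  · rintro ⟨x, a⟩ - ⟨y, b⟩ - h
    simp only [Prod.mk.injEq] at h
    obtain ⟨rfl, h⟩ := h
    obtain rfl : x = y := by omega
    rfl

/-- Markov's inequality for a finite sum. -/
theorem card_filter_lt_mul_le {ι : Type*} (S : Finset ι) (f : ι → ℕ) (c : ℝ) :
    ((S.filter fun x => c < f x).card : ℝ) * c ≤ ((∑ x ∈ S, f x : ℕ) : ℝ) := by
  rw [← nsmul_eq_mul]
  refine (Finset.card_nsmul_le_sum _ (fun x => (f x : ℝ)) _
    fun x hx => (Finset.mem_filter.1 hx).2.le).trans ?_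
  push_cast
  exact Finset.sum_le_sum_of_subset_of_nonneg (Finset.filter_subset _ _)
    fun _ _ _ => Nat.cast_nonneg _

theorem card_filter_two_mul_eq_add_le (A S : Finset ℤ) :
    (S.filter fun x => ∃ a ∈ A, ∃ b ∈ A, 2 * x = a + b).card ≤ A.card ^ 2 := by
  rw [sq, ← Finset.card_product]
  refine (Finset.card_le_card (t := (A ×ˢ A).image fun p => (p.1 + p.2) / 2) ?_).trans
    Finset.card_image_le
  intro x hx
  obtain ⟨-, a, ha, b, hb, h⟩ := Finset.mem_filter.1 hx
  exact Finset.mem_image.2 ⟨(a, b), Finset.mem_product.2 ⟨ha, hb⟩, by simp only; omega⟩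

/-! ### The greedy step -/

/-- `A` is a set of `n` positive integers without `m + 1` pairs of the same nonzero difference,
and the number of its differences with more than `j` representations is at most `n ^ 2 / t ^ j`. -/
structure IsBalanced (m n : ℕ) (t : ℝ) (A : Finset ℤ) : Prop where
  card_eq : A.card = n
  pos : ∀ a ∈ A, 0 < a
  card_le : ∀ j < m, ((popularDifferences A (j + 1)).card : ℝ) * t ^ j ≤ (n : ℝ) ^ 2
  eq_empty : popularDifferences A (m + 1) = ∅

theorem isBalanced_singleton (m : ℕ) : IsBalanced m 1 1 {1} where
  card_eq := rfl
  pos := by simp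
  card_le j _ := by
    have := card_popularDifferences_le_sq {1} (j + 1)
    rw [Finset.card_singleton] at this
    simpa using this
  eq_empty := by
    ext d
    rw [mem_popularDifferences (by omega)]
    simp only [Finset.notMem_empty, iff_false, not_and, not_le]
    intro hd
    rw [Finset.card_eq_zero.2]
    · omega
    · ext a
      simp
      omega

/-- Markov: the total is at most `n * n ^ 2 / t ^ j`. Dividing by the threshold loses one factor
`t`, the same for every `j`. -/
theorem IsBalanced.card_large_popularNeighbours_le {m n : ℕ} {t : ℝ} {A : Finset ℤ}
    (h : IsBalanced m n t A) (hn : 1 ≤ n) (ht : 1 ≤ t) {j : ℕ} (hj : j < m) (S : Finset ℤ) :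
    ((S.filter fun x => (n : ℝ) / (2 * t ^ (j + 1)) <
      ((popularNeighbours A (j + 1) x).card : ℝ)).card : ℝ) ≤ 2 * (n : ℝ) ^ 2 * t := by
  have ht0 : 0 < t := by linarith
  have hn0 : (0 : ℝ) < n := by exact_mod_cast hn
  have h1 := card_filter_lt_mul_le S (fun x => (popularNeighbours A (j + 1) x).card)
    ((n : ℝ) / (2 * t ^ (j + 1)))
  have h2 : ((∑ x ∈ S, (popularNeighbours A (j + 1) x).card : ℕ) : ℝ) ≤
      n * (popularDifferences A (j + 1)).card := by
    have := sum_card_popularNeighbours_le A S (j + 1)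
    rw [h.card_eq] at this
    exact_mod_cast this
  have h3 := h1.trans h2
  rw [← mul_div_assoc, div_le_iff₀ (by positivity)] at h3
  refine le_of_mul_le_mul_right (h3.trans ?_) hn0
  calc (n : ℝ) * (popularDifferences A (j + 1)).card * (2 * t ^ (j + 1))
      = 2 * n * t * ((popularDifferences A (j + 1)).card * t ^ j) := by ring
    _ ≤ 2 * n * t * (n : ℝ) ^ 2 := by
      gcongr
      exact h.card_le j hj
    _ = 2 * (n : ℝ) ^ 2 * t * n := by ring

theorem IsBalanced.exists_good {m n N : ℕ} {t : ℝ} {A : Finset ℤ}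
    (h : IsBalanced m n t A) (hn : 1 ≤ n) (ht : 1 ≤ t)
    (hN : (2 * m + 1) * (n : ℝ) ^ 2 * t < N) :
    ∃ x ∈ Finset.Icc (1 : ℤ) N, (∀ a ∈ A, ∀ b ∈ A, 2 * x ≠ a + b) ∧
      ∀ j < m, ((popularNeighbours A (j + 1) x).card : ℝ) ≤ n / (2 * t ^ (j + 1)) := by
  by_contra! hcon
  set S := Finset.Icc (1 : ℤ) N with hS
  -- Bad `x`: at most `n ^ 2` midpoints and `2 * n ^ 2 * t` for each of the `m` levels, fewer than
  -- `N` in all.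
  have hcover : S ⊆ (S.filter fun x => ∃ a ∈ A, ∃ b ∈ A, 2 * x = a + b) ∪
      (Finset.range m).biUnion fun j => S.filter fun x => (n : ℝ) / (2 * t ^ (j + 1)) <
        ((popularNeighbours A (j + 1) x).card : ℝ) := by
    intro x hx
    rw [Finset.mem_union]
    by_cases hx2 : ∃ a ∈ A, ∃ b ∈ A, 2 * x = a + b
    · exact Or.inl (Finset.mem_filter.2 ⟨hx, hx2⟩)
    · push Not at hx2
      obtain ⟨j, hj, hlt⟩ := hcon x hx hx2
      exact Or.inr (Finset.mem_biUnion.2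
        ⟨j, Finset.mem_range.2 hj, Finset.mem_filter.2 ⟨hx, hlt⟩⟩)
  have hcard : (N : ℝ) ≤ (n : ℝ) ^ 2 + ∑ j ∈ Finset.range m, 2 * (n : ℝ) ^ 2 * t := by
    have h1 := (Finset.card_le_card hcover).trans (Finset.card_union_le _ _)
    have h2 := card_filter_two_mul_eq_add_le A S
    rw [h.card_eq] at h2
    have h3 := h1.trans (add_le_add h2 Finset.card_biUnion_le)
    have h4 : S.card = N := by simp [hS]
    rw [h4] at h3
    have h5 : (N : ℝ) ≤ ((n ^ 2 + ∑ j ∈ Finset.range m, (S.filter fun x =>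
        (n : ℝ) / (2 * t ^ (j + 1)) <
          ((popularNeighbours A (j + 1) x).card : ℝ)).card : ℕ) : ℝ) := by
      exact_mod_cast h3
    push_cast at h5
    refine h5.trans (add_le_add le_rfl (Finset.sum_le_sum fun j hj => ?_))
    exact h.card_large_popularNeighbours_le hn ht (Finset.mem_range.1 hj) S
  rw [Finset.sum_const, Finset.card_range, nsmul_eq_mul] at hcard
  have : (n : ℝ) ^ 2 ≤ (n : ℝ) ^ 2 * t := le_mul_of_one_le_right (by positivity) ht
  linarith

theorem IsBalanced.exists_insert {m n N : ℕ} {t t' : ℝ} {A : Finset ℤ}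
    (h : IsBalanced m n t A) (hm : 1 ≤ m) (hn : 1 ≤ n) (ht : 1 ≤ t) (htm : t ^ m = n)
    (htt' : ∀ j ≤ m, t' ^ j * n ≤ (n + 1) * t ^ j)
    (hN : (2 * m + 1) * (n : ℝ) ^ 2 * t < N) :
    ∃ x ∈ Finset.Icc (1 : ℤ) N, IsBalanced m (n + 1) t' (insert x A) := by
  obtain ⟨x, hxN, hx, hgood⟩ := h.exists_good hn ht hN
  have hn0 : (0 : ℝ) < n := by exact_mod_cast hn
  have ht0 : 0 < t := by linarith
  have hxA : x ∉ A := fun hA => hx x hA x hA (two_mul x)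
  refine ⟨x, hxN, ⟨?_, ?_, ?_, ?_⟩⟩
  · rw [Finset.card_insert_of_notMem hxA, h.card_eq]
  · intro a ha
    rcases Finset.mem_insert.1 ha with rfl | ha
    · have := (Finset.mem_Icc.1 hxN).1
      omega
    · exact h.pos a ha
  · intro j hj
    rcases j with _ | j
    · have h1 := card_popularDifferences_le_sq (insert x A) 1
      rw [Finset.card_insert_of_notMem hxA, h.card_eq] at h1
      rw [pow_zero, mul_one]
      exact_mod_cast h1
    · have h1 := card_popularDifferences_insert_le hx (j := j + 1) (by omega)
      have h2 := hgood j (by omega)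
      have h3 := h.card_le (j + 1) hj
      have h4 := htt' (j + 1) hj.le
      rw [le_div_iff₀ (by positivity)] at h2
      have h5 : ((popularDifferences (insert x A) (j + 1 + 1)).card : ℝ) ≤
          (popularDifferences A (j + 1 + 1)).card + 2 * (popularNeighbours A (j + 1) x).card := by
        exact_mod_cast h1
      -- The old differences contribute `n ^ 2`, the promoted ones `2 * (n / 2) = n`.
      have h6 : ((popularDifferences (insert x A) (j + 1 + 1)).card : ℝ) * t ^ (j + 1) ≤
          n * (n + 1) := by
        have := mul_le_mul_of_nonneg_right h5 (pow_pos ht0 (j + 1)).le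
        nlinarith
      refine le_of_mul_le_mul_right ?_ hn0
      calc ((popularDifferences (insert x A) (j + 1 + 1)).card : ℝ) * t' ^ (j + 1) * n
          = (popularDifferences (insert x A) (j + 1 + 1)).card * (t' ^ (j + 1) * n) := by ring
        _ ≤ (popularDifferences (insert x A) (j + 1 + 1)).card * ((n + 1) * t ^ (j + 1)) := by
          gcongr
        _ = (n + 1) * ((popularDifferences (insert x A) (j + 1 + 1)).card * t ^ (j + 1)) := by
          ring
        _ ≤ (n + 1) * (n * (n + 1)) := by gcongr
        _ = ((n + 1 : ℕ) : ℝ) ^ 2 * n := by push_cast; ring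
  · obtain ⟨m, rfl⟩ : ∃ k, m = k + 1 := ⟨m - 1, by omega⟩
    have h1 := card_popularDifferences_insert_le hx (j := m + 1) (by omega)
    have h2 := hgood m (by omega)
    -- At the top level `t ^ m = n` makes the threshold `1 / 2`, so nothing is promoted.
    have h3 : (popularNeighbours A (m + 1) x).card = 0 := by
      rw [htm, div_mul_cancel_right₀ hn0.ne'] at h2
      by_contra hne
      have : (1 : ℝ) ≤ (popularNeighbours A (m + 1) x).card := by
        exact_mod_cast Nat.one_le_iff_ne_zero.2 hne
      norm_num at h2
      linarith
    rw [h.eq_empty, h3] at h1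
    exact Finset.card_eq_zero.1 (by simpa using h1)

theorem rpow_inv_succ_pow_mul_le {m n j : ℕ} (hm : 1 ≤ m) (hn : 1 ≤ n) (hj : j ≤ m) :
    (((n + 1 : ℕ) : ℝ) ^ (m : ℝ)⁻¹) ^ j * n ≤ (n + 1) * ((n : ℝ) ^ (m : ℝ)⁻¹) ^ j := by
  have hn0 : (0 : ℝ) < n := by exact_mod_cast hn
  have hm0 : (0 : ℝ) < m := by exact_mod_cast hm
  rw [← Real.rpow_natCast, ← Real.rpow_natCast, ← Real.rpow_mul (by positivity),
    ← Real.rpow_mul (by positivity), ← div_le_div_iff₀ (by positivity) hn0,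
    ← Real.div_rpow (by positivity) (by positivity)]
  push_cast
  have h1 : (1 : ℝ) ≤ (n + 1) / n := by
    rw [le_div_iff₀ hn0]
    linarith
  have h2 : (m : ℝ)⁻¹ * j ≤ 1 := by
    rw [inv_mul_le_iff₀ hm0, mul_one]
    exact_mod_cast hj
  simpa using Real.rpow_le_rpow_of_exponent_le h1 h2

theorem exists_balanced_chain {m : ℕ} (hm : 1 ≤ m) :
    ∃ A : ℕ → Finset ℤ, Monotone A ∧ ∀ n, 1 ≤ n →
      IsBalanced m n ((n : ℝ) ^ (m : ℝ)⁻¹) (A n) ∧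
      ∀ a ∈ A n, (a : ℝ) ≤ (2 * m + 2) * ((n : ℝ) ^ 2 * (n : ℝ) ^ (m : ℝ)⁻¹) := by
  have hm0 : (0 : ℝ) < m := by exact_mod_cast hm
  let P : ℕ → Finset ℤ → Prop := fun n A =>
    IsBalanced m (n + 1) (((n + 1 : ℕ) : ℝ) ^ (m : ℝ)⁻¹) A ∧
      ∀ a ∈ A, (a : ℝ) ≤ (2 * m + 2) * (((n + 1 : ℕ) : ℝ) ^ 2 * ((n + 1 : ℕ) : ℝ) ^ (m : ℝ)⁻¹)
  have hbase : P 0 {1} := by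
    refine ⟨by simpa using isBalanced_singleton m, fun a ha => ?_⟩
    obtain rfl := Finset.mem_singleton.1 ha
    simp
    linarith
  have hstep : ∀ n A, P n A → ∃ B, A ⊆ B ∧ P (n + 1) B := by
    rintro n A ⟨hA, hbd⟩
    set t := ((n + 1 : ℕ) : ℝ) ^ (m : ℝ)⁻¹ with ht_def
    have ht : 1 ≤ t := Real.one_le_rpow (by simp) (by positivity)
    have hsq : (1 : ℝ) ≤ ((n + 1 : ℕ) : ℝ) ^ 2 := one_le_pow₀ (by simp)
    have hprod : 1 ≤ ((n + 1 : ℕ) : ℝ) ^ 2 * t := one_le_mul_of_one_le_of_one_le hsq ht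
    have hmono : ((n + 1 : ℕ) : ℝ) ^ 2 * t ≤
        ((n + 1 + 1 : ℕ) : ℝ) ^ 2 * ((n + 1 + 1 : ℕ) : ℝ) ^ (m : ℝ)⁻¹ := by
      have : ((n + 1 : ℕ) : ℝ) ≤ ((n + 1 + 1 : ℕ) : ℝ) := by simp
      rw [ht_def]
      gcongr
    set N := ⌊(2 * m + 1) * ((n + 1 : ℕ) : ℝ) ^ 2 * t⌋₊ + 1 with hN_def
    have hN : (2 * m + 1) * ((n + 1 : ℕ) : ℝ) ^ 2 * t < N := by
      rw [hN_def]
      push_cast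
      exact Nat.lt_floor_add_one _
    have hN' : (N : ℝ) ≤ (2 * m + 2) * (((n + 1 : ℕ) : ℝ) ^ 2 * t) := by
      have : (⌊(2 * m + 1) * ((n + 1 : ℕ) : ℝ) ^ 2 * t⌋₊ : ℝ) ≤
        (2 * m + 1) * ((n + 1 : ℕ) : ℝ) ^ 2 * t := Nat.floor_le (by positivity)
      rw [hN_def, Nat.cast_add, Nat.cast_one]
      linarith
    obtain ⟨x, hx, hbal⟩ := hA.exists_insert (t' := ((n + 1 + 1 : ℕ) : ℝ) ^ (m : ℝ)⁻¹)
      hm (by omega) ht (Real.rpow_inv_natCast_pow (by positivity) (by omega))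
      (fun j hj => by
        have := rpow_inv_succ_pow_mul_le hm (n := n + 1) (by omega) hj
        exact_mod_cast this) hN
    refine ⟨insert x A, Finset.subset_insert _ _, hbal, fun a ha => ?_⟩
    have hle : (a : ℝ) ≤ (2 * m + 2) * (((n + 1 : ℕ) : ℝ) ^ 2 * t) := by
      rcases Finset.mem_insert.1 ha with rfl | ha
      · refine le_trans ?_ hN'
        exact_mod_cast (Finset.mem_Icc.1 hx).2
      · exact hbd a ha
    exact hle.trans (by gcongr)
  choose! next hsub hnext using hstep
  let B : ℕ → Finset ℤ := fun n => Nat.rec {1} (fun k A => next k A) n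
  have hB : ∀ n, P n (B n) := fun n => by
    induction n with
    | zero => exact hbase
    | succ k ih => exact hnext k (B k) ih
  have hBmono : Monotone B := monotone_nat_of_le_succ fun n => hsub n (B n) (hB n)
  refine ⟨fun n => B (n - 1), fun a b hab => hBmono (by omega), fun n hn => ?_⟩
  obtain ⟨k, rfl⟩ : ∃ k, n = k + 1 := ⟨n - 1, by omega⟩
  exact hB k

/-! ### Freeness and density of the union -/

theorem isLFree_of_popularDifferences_eq_empty {ι : Type*} [Nonempty ι] [Preorder ι]
    [IsDirectedOrder ι] {A : ι → Finset ℤ} (hA : Monotone A) {ℓ : ℕ} (hℓ : 1 ≤ ℓ)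
    (h : ∀ i, ∃ k, i ≤ k ∧ popularDifferences (A k) ℓ = ∅) :
    IsLFree ![2, ℓ] (⋃ i, (A i : Set ℤ)) := by
  intro L hL hsub
  have h0 : (L 0).card = 2 := hL 0
  have h1 : (L 1).card = ℓ := hL 1
  obtain ⟨u, v, huv, hL0⟩ := Finset.card_eq_two.1 h0
  have hmem : ∀ x ∈ L 0, ∀ y ∈ L 1, x + y ∈ ⋃ i, (A i : Set ℤ) := fun x hx y hy =>
    hsub ⟨![x, y], by simp [Fin.forall_fin_two, hx, hy], by simp⟩
  have hfin : ∃ i, ∀ x ∈ L 0, ∀ y ∈ L 1, x + y ∈ A i := by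
    have hdir : Directed (· ⊆ ·) fun i => (A i : Set ℤ) :=
      Monotone.directed_le fun a b hab => Finset.coe_subset.2 (hA hab)
    obtain ⟨i, hi⟩ := hdir.exists_mem_subset_of_finset_subset_biUnion
      (s := Finset.image₂ (· + ·) (L 0) (L 1)) (by
        intro z hz
        obtain ⟨x, hx, y, hy, rfl⟩ := Finset.mem_image₂.1 (Finset.mem_coe.1 hz)
        exact hmem x hx y hy)
    exact ⟨i, fun x hx y hy => hi (Finset.mem_coe.2 (Finset.mem_image₂_of_mem hx hy))⟩
  obtain ⟨i, hi⟩ := hfin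
  obtain ⟨k, hik, hk⟩ := h i
  -- Each `y ∈ L 1` gives the pair `(u + y, v + y)`.
  have : v - u ∈ popularDifferences (A k) ℓ := by
    rw [mem_popularDifferences hℓ]
    refine ⟨sub_ne_zero.2 huv.symm, ?_⟩
    rw [← h1]
    refine Finset.card_le_card_of_injOn (fun y => u + y) (fun y hy => ?_)
      fun a _ b _ hab => add_left_cancel hab
    have hu := hA hik (hi u (by simp [hL0]) y hy)
    have hv := hA hik (hi v (by simp [hL0]) y hy)
    simp only [Finset.coe_filter, Set.mem_ofPred_eq]
    exact ⟨hu, by rwa [show u + y + (v - u) = v + y by ring]⟩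
  simp [hk] at this

theorem le_countingFunction {A : Set ℤ} {B : Finset ℤ} {x : ℝ} (hBA : (B : Set ℤ) ⊆ A)
    (hpos : ∀ b ∈ B, 0 < b) (hle : ∀ b ∈ B, (b : ℝ) ≤ x) : B.card ≤ countingFunction A x := by
  rw [← Set.ncard_coe_finset]
  refine Set.ncard_le_ncard (fun b hb => ⟨hBA hb, hpos b hb, hle b hb⟩) ?_
  refine (Set.finite_Icc (1 : ℤ) ⌊x⌋).subset ?_
  rintro a ⟨-, h1, h2⟩
  exact ⟨h1, Int.le_floor.2 h2⟩

theorem isBigO_countingFunction {A : Set ℤ} {C β : ℝ} (hC : 0 < C) (hβ : 0 < β)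
    (h : ∀ n : ℕ, 1 ≤ n → ∃ B : Finset ℤ, (B : Set ℤ) ⊆ A ∧ B.card = n ∧
      ∀ b ∈ B, 0 < b ∧ (b : ℝ) ≤ C * (n : ℝ) ^ β) :
    (fun x : ℝ => x ^ β⁻¹) =O[Filter.atTop] fun x : ℝ => (countingFunction A x : ℝ) := by
  refine Asymptotics.IsBigO.of_bound (2 * C ^ β⁻¹) ?_
  filter_upwards [Filter.eventually_ge_atTop C] with x hx
  have hx0 : 0 < x := hC.trans_le hx
  have hy : 1 ≤ (x / C) ^ β⁻¹ := Real.one_le_rpow (by rwa [one_le_div hC]) (by positivity)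
  -- Chosen so that `C * y ^ β = x`. The factor 2 in the bound absorbs the floor, as `y < ⌊y⌋₊ + 1 ≤
  -- 2 * ⌊y⌋₊`.
  set y := (x / C) ^ β⁻¹ with hy_def
  have hfl : 1 ≤ ⌊y⌋₊ := Nat.one_le_floor_iff y |>.2 hy
  obtain ⟨B, hBA, hcard, hB⟩ := h ⌊y⌋₊ hfl
  have hcount : ⌊y⌋₊ ≤ countingFunction A x := by
    rw [← hcard]
    refine le_countingFunction hBA (fun b hb => (hB b hb).1) fun b hb => (hB b hb).2.trans ?_
    calc C * (⌊y⌋₊ : ℝ) ^ β ≤ C * y ^ β := by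
          gcongr
          exact Nat.floor_le (by linarith)
      _ = x := by
          rw [hy_def, Real.rpow_inv_rpow (by positivity) hβ.ne', mul_div_cancel₀ _ hC.ne']
  have hcount' : (⌊y⌋₊ : ℝ) ≤ countingFunction A x := by exact_mod_cast hcount
  have hfl' : (1 : ℝ) ≤ ⌊y⌋₊ := by exact_mod_cast hfl
  have hlt := Nat.lt_floor_add_one y
  rw [Real.norm_of_nonneg (by positivity), Real.norm_of_nonneg (by positivity)]
  have hxy : x ^ β⁻¹ = C ^ β⁻¹ * y := by
    rw [hy_def, ← Real.mul_rpow (by positivity) (by positivity), mul_div_cancel₀ _ hC.ne']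
  rw [hxy, mul_comm 2, mul_assoc]
  gcongr
  linarith

theorem theorem6 (ℓ : ℕ) (hℓ : 2 ≤ ℓ) (ε : ℝ) (hε : 0 < ε) :
    ∃ A : Set ℤ, A.Infinite ∧ (∀ a ∈ A, 0 < a) ∧ IsLFree ![2, ℓ] A ∧
      (fun x : ℝ => x ^ (1 - (ℓ : ℝ) / (2 * (ℓ : ℝ) - 1) - ε))
        =O[Filter.atTop] (fun x : ℝ => (countingFunction A x : ℝ)) := by
  obtain ⟨m, rfl⟩ : ∃ m, ℓ = m + 1 := ⟨ℓ - 1, by omega⟩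
  have hm : 1 ≤ m := by omega
  have hm0 : (0 : ℝ) < m := by exact_mod_cast hm
  obtain ⟨A, hmono, hA⟩ := exists_balanced_chain hm
  refine ⟨⋃ n, (A (n + 1) : Set ℤ), ?_, ?_, ?_, ?_⟩
  · intro hfin
    have hsub : (A (hfin.toFinset.card + 1)) ⊆ hfin.toFinset := fun a ha =>
      hfin.mem_toFinset.2 (Set.mem_iUnion.2 ⟨_, ha⟩)
    have := Finset.card_le_card hsub
    rw [(hA _ (by omega)).1.card_eq] at this
    omega
  · intro a ha
    obtain ⟨n, hn⟩ := Set.mem_iUnion.1 ha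
    exact (hA (n + 1) (by omega)).1.pos a hn
  · exact isLFree_of_popularDifferences_eq_empty (A := fun n => A (n + 1))
      (fun a b hab => hmono (by omega)) (by omega)
      fun i => ⟨i, le_rfl, (hA (i + 1) (by omega)).1.eq_empty⟩
  · have hO := isBigO_countingFunction (A := ⋃ n, (A (n + 1) : Set ℤ)) (C := 2 * m + 2)
      (β := 2 + (m : ℝ)⁻¹) (by positivity) (by positivity) fun n hn => by
        refine ⟨A n, ?_, (hA n hn).1.card_eq, fun b hb => ⟨(hA n hn).1.pos b hb, ?_⟩⟩
        · obtain ⟨k, rfl⟩ : ∃ k, n = k + 1 := ⟨n - 1, by omega⟩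
          exact Set.subset_iUnion (fun n => (A (n + 1) : Set ℤ)) k
        · have hn0 : (0 : ℝ) < n := by exact_mod_cast hn
          rw [Real.rpow_add hn0, Real.rpow_two]
          exact (hA n hn).2 b hb
    refine Asymptotics.IsBigO.trans (Asymptotics.IsBigO.of_bound 1 ?_) hO
    filter_upwards [Filter.eventually_ge_atTop 1] with x hx
    rw [one_mul, Real.norm_of_nonneg (by positivity), Real.norm_of_nonneg (by positivity)]
    refine Real.rpow_le_rpow_of_exponent_le hx ?_
    -- Both sides are `m / (2 * m + 1)`: the construction reaches the exponent with no loss, and `ε`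
    -- only weakens it.
    have : 1 - ((m + 1 : ℕ) : ℝ) / (2 * ((m + 1 : ℕ) : ℝ) - 1) = (2 + (m : ℝ)⁻¹)⁻¹ := by
      push_cast
      rw [show 2 * ((m : ℝ) + 1) - 1 = 2 * m + 1 by ring]
      field_simp
      ring
    linarith
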